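/- Consider the single-server speed-scaling model: jobs arrive as a Poisson process of rate $\lambda>0$ and have i.i.d. exponential sizes with unit mean. A Markovian policy is a sequence $\nu=(\mu_i)_{i\ge 0}$ of service speeds with $\mu_i\in[0,\infty)$ and $\mu_0=0$, where $\mu_i$ is the speed used when $i$ jobs are present; the number of jobs in the system is then a birth-death Markov chain with birth rate $\lambda$ and death rate $\mu_i$ in state $i$. Let $\alpha>0$. If this chain has a stationary distribution $\pi$ (which is then unique), the cost of $\nu$ (mean number of jobs in the system plus $\alpha$ times the quadratic switching cost rate) is $$C_\nu(\lambda)=\sum_{i\ge 0} i\,\pi_i+\alpha\sum_{i\ge 0}\lambda\pi_i(\mu_i-\mu_{i+1})^2+\alpha\sum_{i\ge 1}\mu_i\pi_i(\mu_i-\mu_{i-1})^2\in[0,\infty],$$ and otherwise $C_\nu(\lambda)=\infty$. Let $C_{\mathsf{OPT}}(\lambda)=\inf_\nu C_\nu(\lambda)$ be the optimal cost over all Markovian policies. Lemma. For every $\alpha>0$, $$\liminf_{\lambda\downarrow 0}\frac{C_{\mathsf{OPT}}(\lambda)}{\lambda}\;\ge\;\frac32\,\sqrt[3]{4\alpha}.$$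 Moreover, the policy $\mathsf{ALG}_2$ given by $\mu_i=\frac{1}{\sqrt[3]{4\alpha}}\,i$ is light-traffic optimal, that is, $C_{\mathsf{ALG}_2}(\lambda)/C_{\mathsf{OPT}}(\lambda)\to 1$ as $\lambda\downarrow 0$. -/

import Mathlib

open Filter Topology

namespace SpeedScaling

/-- A (stationary, deterministic) Markovian policy of the single-server speed-scaling model: the
service speed is a function of the number of jobs present. Any speed in `[0, ∞)` is allowed while
jobs are present, and the speed is `0` in the empty system (work neutrality). -/
structure MarkovPolicy where
  speed : ℕ → ℝ
  speed_nonneg : ∀ i, 0 ≤ speed i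
  speed_zero : speed 0 = 0

/-- With Poisson arrivals of rate `lam` and independent unit-mean exponential job sizes, the number
of jobs under the policy `ν` is the birth-death chain on `ℕ` with rates `lam` for `i → i + 1` and
`ν.speed (i + 1)` for `i + 1 → i`. `IsStationary lam ν p` says that `p` is a stationary distribution
of this chain: a probability vector which solves the global balance equations. -/
structure IsStationary (lam : ℝ) (ν : MarkovPolicy) (p : ℕ → ℝ) : Prop where
  nonneg : ∀ i, 0 ≤ p i
  hasSum_one : HasSum p 1
  balance_zero : lam * p 0 = ν.speed 1 * p 1
  balance_succ : ∀ i, (lam + ν.speed (i + 1)) * p (i + 1) =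
    lam * p i + ν.speed (i + 2) * p (i + 2)

/-- The long-run cost rate in stationarity: the mean number of jobs, plus `α` times the rate at which
quadratic switching cost is incurred at arrivals (`i → i + 1`) and at departures (`i + 1 → i`). -/
noncomputable def stationaryCost (α lam : ℝ) (ν : MarkovPolicy) (p : ℕ → ℝ) : ENNReal :=
  (∑' i : ℕ, ENNReal.ofReal ((i : ℝ) * p i)) +
  ENNReal.ofReal α *
    (∑' i : ℕ, ENNReal.ofReal (lam * p i * (ν.speed i - ν.speed (i + 1)) ^ 2)) +
  ENNReal.ofReal α *
    (∑' i : ℕ, ENNReal.ofReal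
      (ν.speed (i + 1) * p (i + 1) * (ν.speed (i + 1) - ν.speed i) ^ 2))

/-- The cost of a Markovian policy: `stationaryCost` at the stationary distribution, which is unique
if it exists (`IsStationary.unique`, `cost_eq`). If there is none (the chain is not positive
recurrent, so the number of jobs grows without bound in the long run), the cost is `∞`. -/
noncomputable def cost (α lam : ℝ) (ν : MarkovPolicy) : ENNReal :=
  ⨅ (p : ℕ → ℝ) (_ : IsStationary lam ν p), stationaryCost α lam ν p

/-- The optimal cost over all Markovian policies (the policy may depend on `lam` and `α`). -/
noncomputable def optCost (α lam : ℝ) : ENNReal :=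
  ⨅ ν : MarkovPolicy, cost α lam ν

/-- The policy whose speed with `i` jobs present is `i / (4 α) ^ (1 / 3)`. -/
noncomputable def alg2 (α : ℝ) (hα : 0 < α) : MarkovPolicy where
  speed i := 1 / (4 * α) ^ (1 / 3 : ℝ) * (i : ℝ)
  speed_nonneg i := by positivity
  speed_zero := by simp

/-- A policy is light-traffic optimal if the ratio of its cost to the optimal cost tends to `1`
as the arrival rate decreases to `0`. -/
def IsLightTrafficOptimal (α : ℝ) (ν : MarkovPolicy) : Prop :=
  Tendsto (fun lam : ℝ => cost α lam ν / optCost α lam) (𝓝[>] 0) (𝓝 1)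

theorem IsStationary.detailed {lam : ℝ} {ν : MarkovPolicy} {p : ℕ → ℝ}
    (h : IsStationary lam ν p) (i : ℕ) : lam * p i = ν.speed (i + 1) * p (i + 1) := by
  induction i with
  | zero => exact h.balance_zero
  | succ i ih =>
    have := h.balance_succ i
    linarith

theorem IsStationary.unique {lam : ℝ} (hlam : 0 < lam) {ν : MarkovPolicy} {p q : ℕ → ℝ}
    (hp : IsStationary lam ν p) (hq : IsStationary lam ν q) : p = q := by
  have key : ∀ k i, ∃ c : ℝ, p i = c * p (i + k) ∧ q i = c * q (i + k) := by
    intro k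
    induction k with
    | zero => exact fun i => ⟨1, by simp, by simp⟩
    | succ k ih =>
      intro i
      obtain ⟨c, h1, h2⟩ := ih i
      have e1 := hp.detailed (i + k)
      have e2 := hq.detailed (i + k)
      refine ⟨c * (ν.speed (i + k + 1) / lam), ?_, ?_⟩
      · rw [h1, ← add_assoc, mul_assoc, div_mul_eq_mul_div, ← e1]
        field_simp
      · rw [h2, ← add_assoc, mul_assoc, div_mul_eq_mul_div, ← e2]
        field_simp
  have cross : ∀ i j, p i * q j = q i * p j := by
    intro i j
    rcases le_total i j with hij | hij
    · obtain ⟨k, rfl⟩ := Nat.exists_eq_add_of_le hij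
      obtain ⟨c, h1, h2⟩ := key k i
      rw [h1, h2]; ring
    · obtain ⟨k, rfl⟩ := Nat.exists_eq_add_of_le hij
      obtain ⟨c, h1, h2⟩ := key k j
      rw [h1, h2]; ring
  funext i
  have s1 := hq.hasSum_one.mul_left (p i)
  have s2 := hp.hasSum_one.mul_left (q i)
  simp only [cross i] at s1
  simpa using s1.unique s2

theorem cost_eq {α lam : ℝ} (hlam : 0 < lam) {ν : MarkovPolicy} {p : ℕ → ℝ}
    (hp : IsStationary lam ν p) : cost α lam ν = stationaryCost α lam ν p := by
  apply le_antisymm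
  · exact iInf₂_le p hp
  · refine le_iInf₂ fun q hq => ?_
    rw [hp.unique hlam hq]

end SpeedScaling

open scoped ENNReal

namespace SpeedScaling

/-! Write c = (4α)^(1/3) and m for the speed in state 1. In light traffic only states 0 and 1
matter. Detailed balance gives m p₁ = λ p₀, so p₁ together with the switches 0 → 1 and 1 → 0 costs λ
p₀ (1/m + 2α m²), which is least at m = 1/c, with value (3/2) c λ p₀. A policy may depend on λ and
keep p₀ small, but the mean number of jobs is at least 1 - p₀; `le_optCost` combines the two bounds
uniformly in the policy. The speeds i/c cost exactly (3/2) c λ (`cost_linear`), which matches to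
first order. -/

theorem IsStationary.tsum_ofReal_mul {lam : ℝ} {ν : MarkovPolicy} {p : ℕ → ℝ}
    (h : IsStationary lam ν p) {a : ℝ} (ha : 0 ≤ a) :
    ∑' i, ENNReal.ofReal (a * p i) = ENNReal.ofReal a := by
  have hs : HasSum (fun i => a * p i) a := by simpa using h.hasSum_one.mul_left a
  rw [← ENNReal.ofReal_tsum_of_nonneg (fun i => mul_nonneg ha (h.nonneg i)) hs.summable,
    hs.tsum_eq]

/-- The mean number of jobs is at least the probability that the system is not empty. -/
theorem IsStationary.one_sub_le_stationaryCost {α lam : ℝ} {ν : MarkovPolicy} {p : ℕ → ℝ}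
    (h : IsStationary lam ν p) :
    ENNReal.ofReal (1 - p 0) ≤ stationaryCost α lam ν p := by
  have hs : HasSum (fun i => p (i + 1)) (1 - p 0) := by
    simpa using (hasSum_nat_add_iff' 1).2 h.hasSum_one
  rw [stationaryCost, add_assoc]
  refine le_add_right ?_
  rw [← hs.tsum_eq, ENNReal.ofReal_tsum_of_nonneg (fun i => h.nonneg _) hs.summable,
    tsum_eq_zero_add' (f := fun i : ℕ => ENNReal.ofReal ((i : ℝ) * p i)) ENNReal.summable]
  refine le_add_left (ENNReal.tsum_le_tsum fun i => ENNReal.ofReal_le_ofReal ?_)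
  have : (1 : ℝ) ≤ ((i + 1 : ℕ) : ℝ) := by simp
  nlinarith [h.nonneg (i + 1)]

/-- The contribution of the states `0` and `1` to the stationary cost. -/
theorem IsStationary.boundary_le_stationaryCost {α lam : ℝ} (hα : 0 ≤ α) (hlam : 0 ≤ lam)
    {ν : MarkovPolicy} {p : ℕ → ℝ} (h : IsStationary lam ν p) :
    ENNReal.ofReal (p 1 + 2 * α * (lam * p 0 * ν.speed 1 ^ 2)) ≤ stationaryCost α lam ν p := by
  have hx : 0 ≤ lam * p 0 * ν.speed 1 ^ 2 :=
    mul_nonneg (mul_nonneg hlam (h.nonneg 0)) (sq_nonneg _)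
  have e : p 1 + 2 * α * (lam * p 0 * ν.speed 1 ^ 2) =
      p 1 + α * (lam * p 0 * ν.speed 1 ^ 2) + α * (lam * p 0 * ν.speed 1 ^ 2) := by ring
  rw [e, ENNReal.ofReal_add (add_nonneg (h.nonneg 1) (mul_nonneg hα hx)) (mul_nonneg hα hx),
    ENNReal.ofReal_add (h.nonneg 1) (mul_nonneg hα hx), ENNReal.ofReal_mul hα, stationaryCost]
  refine add_le_add (add_le_add ?_ ?_) ?_
  · refine le_trans (le_of_eq ?_) (ENNReal.le_tsum 1)
    simp
  · refine mul_le_mul_right (le_trans (le_of_eq ?_) (ENNReal.le_tsum 0)) _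
    simp [ν.speed_zero]
  · refine mul_le_mul_right (le_trans (le_of_eq ?_) (ENNReal.le_tsum 0)) _
    simp [ν.speed_zero, h.balance_zero]

/-- The function `m ↦ 1 / m + c ^ 3 / 2 * m ^ 2` has minimum `3 / 2 * c` on `(0, ∞)`; stated without
division. -/
theorem three_halves_mul_le {c m : ℝ} (hc : 0 ≤ c) (hm : 0 ≤ m) :
    3 / 2 * c * m ≤ 1 + c ^ 3 / 2 * m ^ 3 := by
  have hx : 0 ≤ c * m := mul_nonneg hc hm
  -- With x = c m, the gap is (x³ - 3x + 2)/2 = (x - 1)²(x + 2)/2.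
  nlinarith [mul_nonneg (sq_nonneg (c * m - 1)) (by linarith : 0 ≤ c * m + 2)]

/-- With `c = (4 α) ^ (1 / 3)`, the stationary cost is at least `3 / 2 * c * lam * p 0`. -/
theorem IsStationary.mul_le_stationaryCost {α c lam : ℝ} (hc : 0 < c) (hcα : c ^ 3 = 4 * α)
    (hlam : 0 < lam) {ν : MarkovPolicy} {p : ℕ → ℝ} (h : IsStationary lam ν p) :
    ENNReal.ofReal (3 / 2 * c * lam * p 0) ≤ stationaryCost α lam ν p := by
  have hα : 0 ≤ α := by nlinarith [pow_pos hc 3]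
  refine le_trans (ENNReal.ofReal_le_ofReal ?_) (h.boundary_le_stationaryCost hα hlam.le)
  have hb := h.balance_zero
  rcases (ν.speed_nonneg 1).eq_or_lt with hm | hm
  · have h0 : p 0 = 0 := by
      rw [← hm, zero_mul] at hb
      exact (mul_eq_zero.1 hb).resolve_left hlam.ne'
    simpa [h0] using h.nonneg 1
  · refine le_of_mul_le_mul_left ?_ hm
    have key := mul_le_mul_of_nonneg_right (three_halves_mul_le hc.le hm.le)
      (mul_nonneg hlam.le (h.nonneg 0))
    rw [hcα] at key
    linear_combination key + hb

/-- Put k = (3/2) c λ. If p₀ ≥ 1 - k, the bound k p₀ suffices; otherwise the mean number of jobs is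
at least 1 - p₀ ≥ k ≥ k(1 - k). -/
theorem le_optCost {α c lam : ℝ} (hc : 0 < c) (hcα : c ^ 3 = 4 * α) (hlam : 0 < lam) :
    ENNReal.ofReal (3 / 2 * c * lam * (1 - 3 / 2 * c * lam)) ≤ optCost α lam := by
  refine le_iInf fun ν => le_iInf₂ fun p h => ?_
  have hk : 0 < 3 / 2 * c * lam := by positivity
  rcases le_total (1 - 3 / 2 * c * lam) (p 0) with h0 | h0
  · exact le_trans (ENNReal.ofReal_le_ofReal (mul_le_mul_of_nonneg_left h0 hk.le))
      (h.mul_le_stationaryCost hc hcα hlam)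
  · refine le_trans (ENNReal.ofReal_le_ofReal ?_) h.one_sub_le_stationaryCost
    nlinarith

/-- The stationary distribution of the policy with speeds `i / c` is a Poisson distribution. -/
theorem isStationary_poisson {c lam : ℝ} (hc : 0 < c) (hlam : 0 < lam) {ν : MarkovPolicy}
    (hν : ∀ i, ν.speed i = 1 / c * i) :
    IsStationary lam ν fun i => Real.exp (-(lam * c)) * ((lam * c) ^ i / (i.factorial : ℝ)) := by
  have det : ∀ i : ℕ, lam * (Real.exp (-(lam * c)) * ((lam * c) ^ i / (i.factorial : ℝ))) =
      ν.speed (i + 1) *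
        (Real.exp (-(lam * c)) * ((lam * c) ^ (i + 1) / ((i + 1).factorial : ℝ))) := by
    intro i
    have : (i.factorial : ℝ) ≠ 0 := by positivity
    rw [hν, Nat.factorial_succ]
    push_cast
    field_simp
    ring
  refine ⟨fun i => by positivity, ?_, det 0, fun i => ?_⟩
  · have hs := (NormedSpace.expSeries_div_hasSum_exp (𝔸 := ℝ) (lam * c)).mul_left
      (Real.exp (-(lam * c)))
    rwa [← Real.exp_eq_exp_ℝ, ← Real.exp_add, neg_add_cancel, Real.exp_zero] at hs
  · have h1 := det i
    have h2 := det (i + 1)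
    linear_combination h2 - h1

/-- The cost of the policy with speeds `i / c`, where `c = (4 α) ^ (1 / 3)`. -/
theorem cost_linear {α c lam : ℝ} (hc : 0 < c) (hcα : c ^ 3 = 4 * α) (hlam : 0 < lam)
    {ν : MarkovPolicy} (hν : ∀ i, ν.speed i = 1 / c * i) :
    cost α lam ν = ENNReal.ofReal (3 / 2 * c * lam) := by
  -- The Poisson formula is needed only for existence: detailed balance and total mass 1 determine
  -- all three sums.
  obtain ⟨p, h⟩ : ∃ p, IsStationary lam ν p := ⟨_, isStationary_poisson hc hlam hν⟩
  have hα : 0 ≤ α := by nlinarith [pow_pos hc 3]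
  have mean : ∑' i : ℕ, ENNReal.ofReal ((i : ℝ) * p i) = ENNReal.ofReal (lam * c) := by
    rw [tsum_eq_zero_add' ENNReal.summable, ← h.tsum_ofReal_mul (mul_pos hlam hc).le]
    simp only [Nat.cast_zero, zero_mul, ENNReal.ofReal_zero, zero_add]
    refine tsum_congr fun i => congrArg ENNReal.ofReal ?_
    have d := h.detailed i
    rw [hν] at d
    rw [mul_right_comm, d]
    field_simp
  have up : ∑' i : ℕ, ENNReal.ofReal (lam * p i * (ν.speed i - ν.speed (i + 1)) ^ 2) =
      ENNReal.ofReal (lam / c ^ 2) := by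
    rw [← h.tsum_ofReal_mul (by positivity)]
    refine tsum_congr fun i => congrArg ENNReal.ofReal ?_
    rw [hν, hν]
    push_cast
    field_simp
    ring
  have down : ∑' i : ℕ, ENNReal.ofReal
      (ν.speed (i + 1) * p (i + 1) * (ν.speed (i + 1) - ν.speed i) ^ 2) =
      ENNReal.ofReal (lam / c ^ 2) := by
    rw [← up]
    refine tsum_congr fun i => congrArg ENNReal.ofReal ?_
    rw [← h.detailed i]
    ring
  rw [cost_eq hlam h, stationaryCost, mean, up, down, ← ENNReal.ofReal_mul hα,
    ← ENNReal.ofReal_add (by positivity) (by positivity),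
    ← ENNReal.ofReal_add (by positivity) (by positivity)]
  congr 1
  field_simp
  -- The total is λc + 2αλ/c², and c³ = 4α turns the second term into λc/2.
  linear_combination -hcα

theorem rpow_third_pow_three {x : ℝ} (hx : 0 ≤ x) : (x ^ (1 / 3 : ℝ)) ^ 3 = x := by
  rw [← Real.rpow_natCast, ← Real.rpow_mul hx]
  norm_num

theorem le_liminf_optCost_div {α c : ℝ} (hc : 0 < c) (hcα : c ^ 3 = 4 * α) :
    ENNReal.ofReal (3 / 2 * c) ≤
      liminf (fun lam : ℝ => optCost α lam / ENNReal.ofReal lam) (𝓝[>] 0) := by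
  have ht : Tendsto (fun lam : ℝ => ENNReal.ofReal (3 / 2 * c * (1 - 3 / 2 * c * lam)))
      (𝓝[>] 0) (𝓝 (ENNReal.ofReal (3 / 2 * c))) := by
    have hcont : Continuous fun lam : ℝ => ENNReal.ofReal (3 / 2 * c * (1 - 3 / 2 * c * lam)) :=
      ENNReal.continuous_ofReal.comp (by fun_prop)
    simpa using (hcont.tendsto 0).mono_left nhdsWithin_le_nhds
  rw [← ht.liminf_eq]
  refine liminf_le_liminf ?_
  filter_upwards [self_mem_nhdsWithin] with lam hlam
  have hlam : 0 < lam := hlam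
  rw [ENNReal.le_div_iff_mul_le (Or.inl (by simpa using hlam)) (Or.inl ENNReal.ofReal_ne_top),
    ← ENNReal.ofReal_mul' hlam.le]
  refine le_trans (le_of_eq ?_) (le_optCost hc hcα hlam)
  congr 1
  ring

/-- Once k = (3/2) c λ < 1, the cost k and the lower bound k(1 - k) on the optimum squeeze the ratio
between 1 and 1/(1 - k). -/
theorem isLightTrafficOptimal_linear {α c : ℝ} (hc : 0 < c) (hcα : c ^ 3 = 4 * α)
    {ν : MarkovPolicy} (hν : ∀ i, ν.speed i = 1 / c * i) : IsLightTrafficOptimal α ν := by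
  have ht : Tendsto (fun lam : ℝ => ENNReal.ofReal (1 / (1 - 3 / 2 * c * lam)))
      (𝓝[>] 0) (𝓝 1) := by
    have hcont : ContinuousAt (fun lam : ℝ => 1 / (1 - 3 / 2 * c * lam)) 0 :=
      continuousAt_const.div (by fun_prop) (by simp)
    have := ENNReal.tendsto_ofReal hcont.tendsto
    simp only [mul_zero, sub_zero, div_one, ENNReal.ofReal_one] at this
    exact this.mono_left nhdsWithin_le_nhds
  have hsmall : ∀ᶠ lam : ℝ in 𝓝[>] 0, 3 / 2 * c * lam < 1 := by
    have hcont : Continuous fun lam : ℝ => 3 / 2 * c * lam := by fun_prop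
    exact ((hcont.tendsto 0).eventually (gt_mem_nhds (by simp))).filter_mono nhdsWithin_le_nhds
  refine tendsto_of_tendsto_of_tendsto_of_le_of_le' tendsto_const_nhds ht ?_ ?_
  · filter_upwards [self_mem_nhdsWithin, hsmall] with lam hlam hs
    have hlam : 0 < lam := hlam
    have hle : optCost α lam ≤ cost α lam ν := iInf_le _ ν
    have hpos : 0 < optCost α lam := by
      refine lt_of_lt_of_le (ENNReal.ofReal_pos.2 ?_) (le_optCost hc hcα hlam)
      exact mul_pos (by positivity) (sub_pos.2 hs)
    have hfin : optCost α lam ≠ ⊤ := by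
      rw [cost_linear hc hcα hlam hν] at hle
      exact ne_top_of_le_ne_top ENNReal.ofReal_ne_top hle
    rwa [ENNReal.le_div_iff_mul_le (Or.inl hpos.ne') (Or.inl hfin), one_mul]
  · filter_upwards [self_mem_nhdsWithin, hsmall] with lam hlam hs
    have hlam : 0 < lam := hlam
    have hs' : 0 < 1 - 3 / 2 * c * lam := sub_pos.2 hs
    rw [cost_linear hc hcα hlam hν]
    refine ENNReal.div_le_of_le_mul (le_trans (le_of_eq ?_)
      (mul_le_mul_right (le_optCost hc hcα hlam) _))
    rw [← ENNReal.ofReal_mul (by positivity)]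
    rw [mul_left_comm, one_div_mul_cancel hs'.ne', mul_one]

end SpeedScaling

theorem mainTheorem10 (α : ℝ) (hα : 0 < α) :
    ENNReal.ofReal (3 / 2 * (4 * α) ^ (1 / 3 : ℝ)) ≤
      liminf (fun lam : ℝ => SpeedScaling.optCost α lam / ENNReal.ofReal lam) (𝓝[>] 0) ∧
    SpeedScaling.IsLightTrafficOptimal α (SpeedScaling.alg2 α hα) := by
  have hc : 0 < (4 * α) ^ (1 / 3 : ℝ) := by positivity
  have hcα := SpeedScaling.rpow_third_pow_three (by positivity : 0 ≤ 4 * α)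
  exact ⟨SpeedScaling.le_liminf_optCost_div hc hcα,
    SpeedScaling.isLightTrafficOptimal_linear hc hcα fun _ => rfl⟩
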